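/- Let $$\mathcal P=\{(\alpha,\beta)\in\mathbb R^2:\ \alpha-\beta+1>0,\ \alpha\le 2\beta,\ \alpha(\beta+1)\le\beta^2\},\qquad \mathcal P^-=\{(\alpha,\beta)\in\mathbb R^2:\ -2<\alpha\le 0,\ \alpha=2\beta\},$$ and let $\mu(d\tau)=\frac{1}{\tau}\,d\tau$ on $(0,\infty)$. For $(\alpha,\beta)\in\mathcal P$ and $0<a<b<\infty$, a pair $(w,\lambda)$ with $w\in C^1([a,b])$ real-valued and $\lambda\in\mathbb R$ solves the Riccati problem with exponents $(\alpha,\beta)$ on $[a,b]$ if $$w'+\lambda\,\tau^{\alpha-\beta}w^2=\frac{\beta+1}{\tau}\,w\ \text{ on }(a,b),\qquad w(a)=w(b)=1.$$ Let $(\alpha,\beta)\in\mathcal P\setminus\mathcal P^-$ and $0<a<b<\infty$. Let $(w,\lambda)$ solve the Riccati problem with exponents $(\alpha,\beta)$ on $[a,b]$, and let $(w_0,\lambda_0)$ solve the Riccati problem with exponents $(0,0)$ on the same interval. Then $w>1$ and $w_0>1$ on $(a,b)$, so that the integrands below are well defined and non-negative there, and the following hold (integrals of non-negative functions being understood in $[0,\infty]$).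 (i) For every strictly decreasing $\varphi\in C^1((1,\infty))$ with $\varphi\ge 0$ and $\int_a^b\varphi(w_0)\,d\mu<\infty$, $$\int_a^b\varphi(w)\,d\mu>\int_a^b\varphi(w_0)\,d\mu .$$ (ii) In particular, $$\int_a^b\frac{1}{\sqrt{w^2-1}}\,d\mu>\pi .$$ -/

import Mathlib

open Set MeasureTheory

/-- The admissible set `𝒫` of pairs `(α, β)` of exponents. -/
def paramSet : Set (ℝ × ℝ) :=
  {p | 0 < p.1 - p.2 + 1 ∧ p.1 ≤ 2 * p.2 ∧ p.1 * (p.2 + 1) ≤ p.2 ^ 2}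

/-- The exceptional set `𝒫⁻` of pairs `(α, β)` of exponents. -/
def paramSetMinus : Set (ℝ × ℝ) :=
  {p | -2 < p.1 ∧ p.1 ≤ 0 ∧ p.1 = 2 * p.2}

/-- The measure `μ(dx) = (1/x) dx` on the half-line, as a measure on `ℝ`. -/
noncomputable def logMeasure : Measure ℝ :=
  (volume.restrict (Ioi 0)).withDensity (fun x => ENNReal.ofReal (1 / x))

/-- `(w, l)` solves the Riccati problem
`w' + l τ ^ (α - β) w² = (β + 1) w / τ` on `(a, b)`, `w(a) = w(b) = 1`,
with `w` of class `C¹` on `[a, b]`. -/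
structure IsRiccatiSolution (α β a b : ℝ) (w : ℝ → ℝ) (l : ℝ) : Prop where
  contDiffOn : ContDiffOn ℝ 1 w (Icc a b)
  ode : ∀ τ ∈ Ioo a b,
    deriv w τ + l * τ ^ (α - β) * (w τ) ^ 2 = (β + 1) / τ * w τ
  left : w a = 1
  right : w b = 1

/-! Put `A = α - β + 1`, `B = β + 1`, `2 * H = log b - log a`. In the centred logarithmic variable
`x`, `u = 1 / w` solves the linear equation `u'' = (A - B) u' + A B u` with `u (±H) = 1`, so it is
the explicit convex `profile`; for exponents `(0, 0)` it is `cosh x / cosh H`. The hypotheses on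
`(α, β)` amount to `0 < A < B` and `A * B ≤ 1`.

The integral of `φ (1 / u)` depends only on the lengths of the sublevel intervals of `u`. Let `v h`
be the common value of `u` at the two ends of the sublevel interval of half-length `h`. It suffices
that `v h > cosh h / cosh H` for `0 < h < H`, because `φ` is strictly decreasing. Both sides equal
`1` at `h = H`, so this reduces to `v' / v < tanh h` (`levelRate_lt_tanh`).

Let `a` and `b` be the reciprocals of `|u' / u|` at the left and right ends. Then `G = v' / v = 2 /
(a + b)`, and the Riccati equation of `u' / u` turns `G' < 1 - G ^ 2` into `(A B - 1) (a + b)² + 3 A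
B (b - a)² - 4 (B - A) (b - a) < 0`. This follows from `A B ≤ 1` and `0 < b - a ≤ (B - A) / (A B)`
(`invSlope_diff_le`). Since `tanh' = 1 - tanh²` and `G → 0` at `0`, comparison gives `G < tanh`.

For `φ t = 1 / √(t² - 1)` the reference integral is exactly `π`, which gives (ii). -/

/-! ### Estimates for `x * coth x` -/

/-- The hyperbolic cotangent. -/
noncomputable def coth (x : ℝ) : ℝ := Real.cosh x / Real.sinh x

lemma hasDerivAt_coth {x : ℝ} (hx : 0 < x) : HasDerivAt coth (1 - coth x ^ 2) x := by
  have hs : Real.sinh x ≠ 0 := (Real.sinh_pos_iff.2 hx).ne'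
  refine HasDerivAt.congr_deriv ((Real.hasDerivAt_cosh x).div (Real.hasDerivAt_sinh x) hs) ?_
  unfold coth
  field_simp

lemma one_lt_coth {x : ℝ} (hx : 0 < x) : 1 < coth x := by
  rw [coth, one_lt_div (Real.sinh_pos_iff.2 hx)]
  exact Real.sinh_lt_cosh x

lemma hasDerivAt_mul_coth {x : ℝ} (hx : 0 < x) :
    HasDerivAt (fun z => z * coth z) ((Real.sinh x * Real.cosh x - x) / Real.sinh x ^ 2) x := by
  have hs : Real.sinh x ≠ 0 := (Real.sinh_pos_iff.2 hx).ne'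
  refine HasDerivAt.congr_deriv ((hasDerivAt_id x).mul (hasDerivAt_coth hx)) ?_
  unfold coth
  simp only [id]
  field_simp
  linear_combination (-x) * Real.cosh_sq x

lemma sinh_le_mul_cosh {x : ℝ} (hx : 0 ≤ x) : Real.sinh x ≤ x * Real.cosh x := by
  have : MonotoneOn (fun z => z * Real.cosh z - Real.sinh z) (Ici 0) := by
    apply monotoneOn_of_hasDerivWithinAt_nonneg (convex_Ici 0) (by fun_prop)
      (f' := fun z => z * Real.sinh z)
    · intro z _
      refine (HasDerivAt.congr_deriv (((hasDerivAt_id z).mul (Real.hasDerivAt_cosh z)).sub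
        (Real.hasDerivAt_sinh z)) ?_).hasDerivWithinAt
      simp
    · intro z hz
      rw [interior_Ici] at hz
      exact mul_nonneg hz.le (Real.sinh_nonneg_iff.2 hz.le)
  have := this (mem_Ici.2 le_rfl) hx hx
  simpa using this

lemma lt_sinh_mul_cosh {x : ℝ} (hx : 0 < x) : x < Real.sinh x * Real.cosh x := by
  have h1 := Real.self_lt_sinh_iff.2 hx
  have h2 := Real.one_le_cosh x
  nlinarith

/-- For `x > 0` this bounds the derivative of `x * coth x` by `1`. It reduces to `1 - exp (-2x) ≤
2x`. -/
lemma sinh_mul_cosh_sub_le_sq (x : ℝ) :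
    Real.sinh x * Real.cosh x - x ≤ Real.sinh x ^ 2 := by
  have h1 : Real.sinh x * (Real.cosh x - Real.sinh x) = (1 - Real.exp (-(2 * x))) / 2 := by
    rw [Real.cosh_sub_sinh, Real.sinh_eq, show -(2 * x) = -x + -x by ring, Real.exp_add]
    have : Real.exp x * Real.exp (-x) = 1 := by rw [← Real.exp_add]; simp
    linear_combination this / 2
  have h2 := Real.add_one_le_exp (-(2 * x))
  nlinarith

/-- For `x > 0` this bounds the derivative of `x * coth x` by `2x / 3`, the sharp bound near `0`. -/
lemma sinh_mul_cosh_sub_le {x : ℝ} (hx : 0 ≤ x) :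
    Real.sinh x * Real.cosh x - x ≤ 2 * x / 3 * Real.sinh x ^ 2 := by
  have : MonotoneOn (fun z => 2 * z / 3 * Real.sinh z ^ 2 - (Real.sinh z * Real.cosh z - z))
      (Ici 0) := by
    apply monotoneOn_of_hasDerivWithinAt_nonneg (convex_Ici 0) (by fun_prop)
      (f' := fun z => 4 / 3 * Real.sinh z * (z * Real.cosh z - Real.sinh z))
    · intro z _
      refine (HasDerivAt.congr_deriv (((((hasDerivAt_id z).const_mul 2).div_const 3).mul
        ((Real.hasDerivAt_sinh z).pow 2)).sub
        (((Real.hasDerivAt_sinh z).mul (Real.hasDerivAt_cosh z)).sub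
        (hasDerivAt_id z))) ?_).hasDerivWithinAt
      simp only [id, Pi.pow_apply]
      push_cast
      linear_combination -Real.cosh_sq z
    · intro z hz
      rw [interior_Ici] at hz
      have h1 := sinh_le_mul_cosh (le_of_lt hz)
      have h2 := Real.sinh_nonneg_iff.2 (le_of_lt hz)
      exact mul_nonneg (by positivity) (by linarith)
  have := this (mem_Ici.2 le_rfl) hx hx
  simp at this
  linarith

lemma mul_coth_le {x : ℝ} (hx : 0 < x) : x * coth x ≤ 1 + x ^ 2 / 3 := by
  have : MonotoneOn (fun z => (1 + z ^ 2 / 3) * Real.sinh z - z * Real.cosh z) (Ici 0) := by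
    apply monotoneOn_of_hasDerivWithinAt_nonneg (convex_Ici 0) (by fun_prop)
      (f' := fun z => z / 3 * (z * Real.cosh z - Real.sinh z))
    · intro z _
      refine (HasDerivAt.congr_deriv ((((((hasDerivAt_id z).pow 2).div_const 3).const_add 1).mul
        (Real.hasDerivAt_sinh z)).sub
        ((hasDerivAt_id z).mul (Real.hasDerivAt_cosh z))) ?_).hasDerivWithinAt
      simp only [id, Pi.pow_apply]
      push_cast
      ring
    · intro z hz
      rw [interior_Ici] at hz
      have h1 := sinh_le_mul_cosh (le_of_lt hz)
      exact mul_nonneg (div_nonneg (le_of_lt hz) (by norm_num)) (by linarith)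
  have := this (mem_Ici.2 le_rfl) hx.le hx.le
  simp only [Real.sinh_zero, mul_zero, zero_mul, sub_zero, sub_nonneg] at this
  rw [coth, ← mul_div_assoc, div_le_iff₀ (Real.sinh_pos_iff.2 hx)]
  exact this

lemma one_le_mul_coth {x : ℝ} (hx : 0 < x) : 1 ≤ x * coth x := by
  rw [coth, ← mul_div_assoc, one_le_div (Real.sinh_pos_iff.2 hx)]
  exact sinh_le_mul_cosh hx.le

lemma mul_coth_strictMonoOn : StrictMonoOn (fun z => z * coth z) (Ioi 0) := by
  apply strictMonoOn_of_deriv_pos (convex_Ioi 0)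
  · exact fun z hz => (hasDerivAt_mul_coth hz).continuousAt.continuousWithinAt
  · intro z hz
    rw [interior_Ioi] at hz
    rw [(hasDerivAt_mul_coth hz).deriv]
    have := lt_sinh_mul_cosh hz
    have hs := Real.sinh_pos_iff.2 hz
    exact div_pos (by linarith) (by positivity)

lemma mul_coth_sub_le_sub {x y : ℝ} (hx : 0 < x) (hxy : x ≤ y) :
    y * coth y - x * coth x ≤ y - x := by
  have : AntitoneOn (fun z => z * coth z - z) (Ioi 0) := by
    have hd : ∀ z ∈ Ioi (0 : ℝ), HasDerivAt (fun z => z * coth z - z)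
        ((Real.sinh z * Real.cosh z - z) / Real.sinh z ^ 2 - 1) z :=
      fun z hz => (hasDerivAt_mul_coth hz).sub (hasDerivAt_id z)
    apply antitoneOn_of_deriv_nonpos (convex_Ioi 0)
    · exact fun z hz => (hd z hz).continuousAt.continuousWithinAt
    · rw [interior_Ioi]
      exact fun z hz => (hd z hz).differentiableAt.differentiableWithinAt
    · rw [interior_Ioi]
      intro z hz
      have hs := Real.sinh_pos_iff.2 hz
      rw [(hd z hz).deriv, sub_nonpos, div_le_one (by positivity)]
      exact sinh_mul_cosh_sub_le_sq z
  have := this hx (hx.trans_le hxy) hxy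
  simp only at this
  linarith

lemma mul_coth_sub_le_sq_sub {x y : ℝ} (hx : 0 < x) (hxy : x ≤ y) :
    y * coth y - x * coth x ≤ (y ^ 2 - x ^ 2) / 3 := by
  have : AntitoneOn (fun z => z * coth z - z ^ 2 / 3) (Ioi 0) := by
    have hd : ∀ z ∈ Ioi (0 : ℝ), HasDerivAt (fun z => z * coth z - z ^ 2 / 3)
        ((Real.sinh z * Real.cosh z - z) / Real.sinh z ^ 2 - 2 * z / 3) z := by
      intro z hz
      refine HasDerivAt.congr_deriv
        ((hasDerivAt_mul_coth hz).sub (((hasDerivAt_id z).pow 2).div_const 3)) ?_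
      simp
    apply antitoneOn_of_deriv_nonpos (convex_Ioi 0)
    · exact fun z hz => (hd z hz).continuousAt.continuousWithinAt
    · rw [interior_Ioi]
      exact fun z hz => (hd z hz).differentiableAt.differentiableWithinAt
    · rw [interior_Ioi]
      intro z hz
      have hs := Real.sinh_pos_iff.2 hz
      rw [(hd z hz).deriv, sub_nonpos, div_le_iff₀ (by positivity)]
      exact sinh_mul_cosh_sub_le (le_of_lt hz)
  have := this hx (hx.trans_le hxy) hxy
  simp only at this
  linarith

lemma hasDerivAt_coth_mul {A h : ℝ} (hA : 0 < A) (hh : 0 < h) :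
    HasDerivAt (fun h => coth (A * h)) (A * (1 - coth (A * h) ^ 2)) h := by
  refine HasDerivAt.congr_deriv
    ((hasDerivAt_coth (mul_pos hA hh)).comp h ((hasDerivAt_id h).const_mul A)) ?_
  simp [mul_comm]

/-! ### Logarithmic slopes at the ends of a level interval -/

section LevelSlopes

variable {A B h : ℝ}

/-- Reciprocal of the descending slope at the left end of a level interval of half-length `h`. -/
noncomputable def leftInvSlope (A B h : ℝ) : ℝ :=
  (coth (A * h) + coth (B * h)) / (B * coth (B * h) - A * coth (A * h) + A + B)

/-- Reciprocal of the ascending slope at the right end of a level interval of half-length `h`. -/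
noncomputable def rightInvSlope (A B h : ℝ) : ℝ :=
  (coth (A * h) + coth (B * h)) / (A * coth (A * h) - B * coth (B * h) + A + B)

lemma coth_diff_pos (hA : 0 < A) (hAB : A < B) (hh : 0 < h) :
    0 < B * coth (B * h) - A * coth (A * h) := by
  have := mul_coth_strictMonoOn (mul_pos hA hh) (mul_pos (hA.trans hAB) hh)
    (mul_lt_mul_of_pos_right hAB hh)
  simp only at this
  have h2 : 0 < h * (B * coth (B * h) - A * coth (A * h)) := by linarith
  exact (mul_pos_iff_of_pos_left hh).1 h2

lemma coth_diff_le (hA : 0 < A) (hAB : A < B) (hh : 0 < h) :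
    B * coth (B * h) - A * coth (A * h) ≤ B - A := by
  have := mul_coth_sub_le_sub (mul_pos hA hh) (mul_le_mul_of_nonneg_right hAB.le hh.le)
  refine le_of_mul_le_mul_left ?_ hh
  linarith

lemma inv_lt_leftInvSlope (hA : 0 < A) (hAB : A < B) (hh : 0 < h) :
    1 / B < leftInvSlope A B h := by
  have h1 := coth_diff_pos hA hAB hh
  have h2 := one_lt_coth (mul_pos hA hh)
  rw [leftInvSlope, div_lt_div_iff₀ (hA.trans hAB) (by linarith)]
  nlinarith

lemma inv_lt_rightInvSlope (hA : 0 < A) (hAB : A < B) (hh : 0 < h) :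
    1 / A < rightInvSlope A B h := by
  have h1 := coth_diff_le hA hAB hh
  have h2 := one_lt_coth (mul_pos (hA.trans hAB) hh)
  rw [rightInvSlope, div_lt_div_iff₀ hA (by linarith)]
  nlinarith

lemma leftInvSlope_lt_rightInvSlope (hA : 0 < A) (hAB : A < B) (hh : 0 < h) :
    leftInvSlope A B h < rightInvSlope A B h := by
  have h1 := coth_diff_pos hA hAB hh
  have h2 := coth_diff_le hA hAB hh
  have h3 := one_lt_coth (mul_pos hA hh)
  have h4 := one_lt_coth (mul_pos (hA.trans hAB) hh)
  exact div_lt_div_of_pos_left (by linarith) (by linarith) (by linarith)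

/-- The slope `y = u' / u` satisfies `y' = A B + (A - B) y - y²`, and the left end moves at speed
`-2a / (a + b)` in `h`; the formula is the chain rule for `a = -1 / y`. The proof checks it directly
on the closed form. -/
lemma hasDerivAt_leftInvSlope (hA : 0 < A) (hAB : A < B) (hh : 0 < h) :
    HasDerivAt (leftInvSlope A B)
      (-2 * (A * B * leftInvSlope A B h ^ 3 + (B - A) * leftInvSlope A B h ^ 2
        - leftInvSlope A B h) / (leftInvSlope A B h + rightInvSlope A B h)) h := by
  have h1 := coth_diff_pos hA hAB hh
  have h2 := coth_diff_le hA hAB hh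
  have h3 := one_lt_coth (mul_pos hA hh)
  have h4 := one_lt_coth (mul_pos (hA.trans hAB) hh)
  have dp := hasDerivAt_coth_mul hA hh
  have dq := hasDerivAt_coth_mul (hA.trans hAB) hh
  have hne : B * coth (B * h) - A * coth (A * h) + A + B ≠ 0 := by linarith
  have hne' : A * coth (A * h) - B * coth (B * h) + A + B ≠ 0 := by linarith
  refine HasDerivAt.congr_deriv ((dp.add dq).div
    ((((dq.const_mul B).sub (dp.const_mul A)).add_const A).add_const B) hne) ?_
  simp only [leftInvSlope, rightInvSlope, Pi.add_apply]
  generalize coth (A * h) = p at *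
  generalize coth (B * h) = q at *
  have hpq : p + q ≠ 0 := by linarith
  have hABne : A + B ≠ 0 := by linarith
  have hs : (p + q) / (B * q - A * p + A + B) + (p + q) / (A * p - B * q + A + B) =
      2 * (A + B) * (p + q) / ((B * q - A * p + A + B) * (A * p - B * q + A + B)) := by
    rw [div_add_div _ _ hne hne', div_left_inj' (mul_ne_zero hne hne')]
    ring
  rw [hs]
  field_simp
  ring

lemma hasDerivAt_rightInvSlope (hA : 0 < A) (hAB : A < B) (hh : 0 < h) :
    HasDerivAt (rightInvSlope A B)
      (-2 * (A * B * rightInvSlope A B h ^ 3 - (B - A) * rightInvSlope A B h ^ 2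
        - rightInvSlope A B h) / (leftInvSlope A B h + rightInvSlope A B h)) h := by
  have h1 := coth_diff_pos hA hAB hh
  have h2 := coth_diff_le hA hAB hh
  have h3 := one_lt_coth (mul_pos hA hh)
  have h4 := one_lt_coth (mul_pos (hA.trans hAB) hh)
  have dp := hasDerivAt_coth_mul hA hh
  have dq := hasDerivAt_coth_mul (hA.trans hAB) hh
  have hne : B * coth (B * h) - A * coth (A * h) + A + B ≠ 0 := by linarith
  have hne' : A * coth (A * h) - B * coth (B * h) + A + B ≠ 0 := by linarith
  refine HasDerivAt.congr_deriv ((dp.add dq).div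
    ((((dp.const_mul A).sub (dq.const_mul B)).add_const A).add_const B) hne') ?_
  simp only [leftInvSlope, rightInvSlope, Pi.add_apply]
  generalize coth (A * h) = p at *
  generalize coth (B * h) = q at *
  have hpq : p + q ≠ 0 := by linarith
  have hABne : A + B ≠ 0 := by linarith
  have hs : (p + q) / (B * q - A * p + A + B) + (p + q) / (A * p - B * q + A + B) =
      2 * (A + B) * (p + q) / ((B * q - A * p + A + B) * (A * p - B * q + A + B)) := by
    rw [div_add_div _ _ hne hne', div_left_inj' (mul_ne_zero hne hne')]
    ring
  rw [hs]
  field_simp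
  ring

/-- Starting point for the barrier argument of `invSlope_diff_le`: for small `h` the Taylor bounds
on `x * coth x` suffice. -/
lemma invSlope_diff_le_of_small (hA : 0 < A) (hAB : A < B) (hh : 0 < h)
    (hsmall : (A * h) ^ 2 + (B * h) ^ 2 ≤ 3) :
    rightInvSlope A B h - leftInvSlope A B h ≤ (B - A) / (A * B) := by
  have hB := hA.trans hAB
  have hx := mul_pos hA hh
  have hy := mul_pos hB hh
  have hxy : A * h < B * h := mul_lt_mul_of_pos_right hAB hh
  have h1 := coth_diff_pos hA hAB hh
  have h2 := coth_diff_le hA hAB hh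
  have h3 := mul_coth_le hx
  have h4 := mul_coth_le hy
  have h5 := mul_coth_sub_le_sq_sub hx hxy.le
  have e : rightInvSlope A B h - leftInvSlope A B h =
      2 * (B * coth (B * h) - A * coth (A * h)) * (coth (A * h) + coth (B * h)) /
        ((B * coth (B * h) - A * coth (A * h) + A + B) *
          (A * coth (A * h) - B * coth (B * h) + A + B)) := by
    have hne : B * coth (B * h) - A * coth (A * h) + A + B ≠ 0 := by linarith
    have hne' : A * coth (A * h) - B * coth (B * h) + A + B ≠ 0 := by linarith
    rw [rightInvSlope, leftInvSlope, div_sub_div _ _ hne' hne, mul_comm _ (A * _ - _ + _ + _),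
      div_left_inj' (mul_ne_zero hne' hne)]
    ring
  rw [e, div_le_div_iff₀ (mul_pos (by linarith) (by linarith)) (mul_pos hA hB)]
  have hp := (one_lt_coth hx).trans' one_pos
  have hq := (one_lt_coth hy).trans' one_pos
  -- rescaled quantities
  obtain ⟨x, rfl⟩ : ∃ x, A = x / h := ⟨A * h, by field_simp⟩
  obtain ⟨y, rfl⟩ : ∃ y, B = y / h := ⟨B * h, by field_simp⟩
  simp only [div_mul_cancel₀ _ hh.ne'] at *
  generalize coth x = p at *
  generalize coth y = q at *
  have hD : 0 < y * q - x * p := by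
    have := mul_pos hh h1
    field_simp at this
    linarith
  set D := y * q - x * p with hDdef
  have k1 : x * y * (p + q) ≤ (x + y) * (1 + x * y / 3) := by nlinarith
  have k2 : 2 * D * (x * y * (p + q)) ≤
      2 * ((y ^ 2 - x ^ 2) / 3) * ((x + y) * (1 + x * y / 3)) := by
    have : 0 < x * y * (p + q) := by positivity
    gcongr
    linarith
  have k3 : D ^ 2 ≤ ((y ^ 2 - x ^ 2) / 3) ^ 2 := by gcongr
  -- The difference of the two sides carries the factor `3 - (x² + y²)`, whence the threshold `3`.
  have k4 : 2 * ((y ^ 2 - x ^ 2) / 3) * ((x + y) * (1 + x * y / 3)) ≤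
      (y - x) * ((x + y) ^ 2 - ((y ^ 2 - x ^ 2) / 3) ^ 2) := by
    have : (y - x) * ((x + y) ^ 2 - ((y ^ 2 - x ^ 2) / 3) ^ 2) -
        2 * ((y ^ 2 - x ^ 2) / 3) * ((x + y) * (1 + x * y / 3)) =
        (y - x) * (x + y) ^ 2 * (3 - (x ^ 2 + y ^ 2)) / 9 := by ring
    have h6 : 0 ≤ (y - x) * (x + y) ^ 2 * (3 - (x ^ 2 + y ^ 2)) / 9 := by
      have : 0 ≤ y - x := by linarith
      have : 0 ≤ 3 - (x ^ 2 + y ^ 2) := by linarith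
      positivity
    linarith
  have k5 : 2 * D * (x * y * (p + q)) ≤ (y - x) * ((x + y) ^ 2 - D ^ 2) := by
    refine k2.trans (k4.trans ?_)
    have : 0 ≤ y - x := by linarith
    gcongr
  have l : 2 * (y / h * q - x / h * p) * (p + q) * (x / h * (y / h)) =
      2 * D * (x * y * (p + q)) / h ^ 3 := by
    rw [hDdef]; field_simp
  have r : (y / h - x / h) * ((y / h * q - x / h * p + x / h + y / h) *
      (x / h * p - y / h * q + x / h + y / h)) = (y - x) * ((x + y) ^ 2 - D ^ 2) / h ^ 3 := by
    rw [hDdef]; field_simp; ring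
  rw [l, r]
  gcongr

/-- Barrier argument: the bound holds at some small `ε`, and wherever equality occurs the difference
is strictly decreasing in `h`, so it cannot cross the bound. -/
lemma invSlope_diff_le (hA : 0 < A) (hAB : A < B) (hh : 0 < h) :
    rightInvSlope A B h - leftInvSlope A B h ≤ (B - A) / (A * B) := by
  have hB := hA.trans hAB
  obtain ⟨ε, hε, hεh, hsmall⟩ : ∃ ε, 0 < ε ∧ ε ≤ h ∧ (A * ε) ^ 2 + (B * ε) ^ 2 ≤ 3 := by
    refine ⟨min h (1 / B), lt_min hh (by positivity), min_le_left _ _, ?_⟩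
    have h1 : B * min h (1 / B) ≤ 1 := by
      calc B * min h (1 / B) ≤ B * (1 / B) := by gcongr; exact min_le_right _ _
        _ = 1 := by field_simp
    have h0 : 0 < min h (1 / B) := lt_min hh (by positivity)
    have h2 : A * min h (1 / B) ≤ 1 := le_trans (by gcongr) h1
    have h3 : 0 < A * min h (1 / B) := by positivity
    have h4 : 0 < B * min h (1 / B) := by positivity
    nlinarith
  have hd : ∀ z, 0 < z → HasDerivAt (fun z => rightInvSlope A B z - leftInvSlope A B z) _ z :=
    fun z hz => (hasDerivAt_rightInvSlope hA hAB hz).sub (hasDerivAt_leftInvSlope hA hAB hz)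
  refine image_le_of_deriv_right_lt_deriv_boundary (a := ε) (b := h) (B' := fun _ => 0)
    (B := fun _ => (B - A) / (A * B))
    (fun z hz => (hd z (hε.trans_le hz.1)).continuousAt.continuousWithinAt)
    (fun z hz => (hd z (hε.trans_le hz.1)).hasDerivWithinAt)
    (invSlope_diff_le_of_small hA hAB hε hsmall) (fun z => hasDerivAt_const _ _) ?_
    (right_mem_Icc.2 hεh)
  intro z hz heq
  have hz0 := hε.trans_le hz.1
  have ha := inv_lt_leftInvSlope hA hAB hz0
  have hb := inv_lt_rightInvSlope hA hAB hz0
  have hab := leftInvSlope_lt_rightInvSlope hA hAB hz0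
  generalize leftInvSlope A B z = a at *
  generalize rightInvSlope A B z = b at *
  have hapos : 0 < a := lt_trans (by positivity) ha
  have hbpos : 0 < b := hapos.trans hab
  -- With this relation the derivative of `b - a` collapses to `-2 (b - a) (A B a b - 1) / (a + b)`,
  -- negative since `a > 1 / B` and `b > 1 / A`.
  have e : B - A = A * B * (b - a) := by rw [heq]; field_simp
  rw [div_lt_iff₀ hB] at ha
  rw [div_lt_iff₀ hA] at hb
  have hprod : 1 < A * B * (a * b) := by nlinarith
  rw [← sub_div, div_lt_iff₀ (by positivity), e]
  have : 0 < 2 * (b - a) * (A * B * (a * b) - 1) :=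
    mul_pos (by linarith) (by linarith)
  linarith

/-! ### Comparison of the growth rate of levels with `tanh` -/

/-- Logarithmic growth rate of the level of `u` with respect to the half-length of the
level interval. -/
noncomputable def levelRate (A B h : ℝ) : ℝ := 2 / (leftInvSlope A B h + rightInvSlope A B h)

lemma levelRate_pos (hA : 0 < A) (hAB : A < B) (hh : 0 < h) : 0 < levelRate A B h := by
  have ha := inv_lt_leftInvSlope hA hAB hh
  have hb := inv_lt_rightInvSlope hA hAB hh
  have := one_div_pos.2 hA
  have := one_div_pos.2 (hA.trans hAB)
  exact div_pos two_pos (by linarith)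

/-- By AM-GM, `a + b > 1 / A + 1 / B ≥ 2 / √(A B) ≥ 2`. -/
lemma levelRate_lt_one (hA : 0 < A) (hAB : A < B) (hP : A * B ≤ 1) (hh : 0 < h) :
    levelRate A B h < 1 := by
  have ha := inv_lt_leftInvSlope hA hAB hh
  have hb := inv_lt_rightInvSlope hA hAB hh
  have hB := hA.trans hAB
  have h1 := one_div_pos.2 hA
  have h2 := one_div_pos.2 hB
  have h3 : 1 ≤ (1 / A) * (1 / B) := by
    rw [one_div_mul_one_div, le_div_iff₀ (by positivity)]
    linarith
  rw [levelRate, div_lt_one (by linarith)]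
  nlinarith [sq_nonneg (1 / A - 1 / B)]

lemma levelRate_le (hA : 0 < A) (hAB : A < B) (hh : 0 < h) :
    levelRate A B h ≤ 2 * A * B * h := by
  have hab := leftInvSlope_lt_rightInvSlope hA hAB hh
  have hB := hA.trans hAB
  have h1 := coth_diff_pos hA hAB hh
  have h2 := coth_diff_le hA hAB hh
  have h3 := one_le_mul_coth (mul_pos hA hh)
  have h4 := one_lt_coth (mul_pos hB hh)
  have ha : 1 / (2 * A * B * h) ≤ leftInvSlope A B h := by
    rw [leftInvSlope, div_le_div_iff₀ (by positivity) (by linarith)]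
    have : 0 < 2 * B * (A * h) * coth (B * h) := by positivity
    nlinarith
  have : 0 < 1 / (2 * A * B * h) := by positivity
  rw [levelRate, div_le_iff₀ (by linarith)]
  rw [div_le_iff₀ (by positivity)] at ha
  have : 0 < 2 * A * B * h := by positivity
  nlinarith

lemma hasDerivAt_levelRate (hA : 0 < A) (hAB : A < B) (hP : A * B ≤ 1) (hh : 0 < h) :
    ∃ g, HasDerivAt (levelRate A B) g h ∧ g < 1 - levelRate A B h ^ 2 := by
  have ha := inv_lt_leftInvSlope hA hAB hh
  have hab := leftInvSlope_lt_rightInvSlope hA hAB hh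
  have hD := invSlope_diff_le hA hAB hh
  have hB := hA.trans hAB
  have hapos : 0 < leftInvSlope A B h := lt_trans (by positivity) ha
  have hS : 0 < leftInvSlope A B h + rightInvSlope A B h := by linarith
  refine ⟨_, (hasDerivAt_const h (2 : ℝ)).div
    ((hasDerivAt_leftInvSlope hA hAB hh).add (hasDerivAt_rightInvSlope hA hAB hh)) hS.ne', ?_⟩
  rw [levelRate]
  generalize leftInvSlope A B h = a at *
  generalize rightInvSlope A B h = b at *
  rw [le_div_iff₀ (by positivity)] at hD
  -- The left side is `(a + b)²` times `G' - (1 - G²)`. By `hD` the quadratic term in `b - a` is at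
  -- most `3 (B - A) (b - a)`, which the last term beats.
  have key : (A * B - 1) * (a + b) ^ 2 + 3 * (A * B) * (b - a) ^ 2 -
      4 * (B - A) * (b - a) < 0 := by
    have h1 : (A * B - 1) * (a + b) ^ 2 ≤ 0 :=
      mul_nonpos_of_nonpos_of_nonneg (by linarith) (by positivity)
    have h2 : 0 < (b - a) * (B - A) := mul_pos (by linarith) (by linarith)
    nlinarith
  rw [← sub_pos]
  have e : ∀ x : ℝ, x = -((A * B - 1) * (a + b) ^ 2 + 3 * (A * B) * (b - a) ^ 2 -
      4 * (B - A) * (b - a)) / (a + b) ^ 2 → 0 < x := by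
    rintro x rfl
    exact div_pos (by linarith) (by positivity)
  apply e
  field_simp
  ring

lemma levelRate_lt_tanh (hA : 0 < A) (hAB : A < B) (hP : A * B ≤ 1) (hh : 0 < h) :
    levelRate A B h < Real.tanh h := by
  have hG0 : ∀ {z}, 0 < z → 0 < levelRate A B z := levelRate_pos hA hAB
  have hG1 : ∀ {z}, 0 < z → levelRate A B z < 1 := levelRate_lt_one hA hAB hP
  -- `F z = 2 (artanh (G z) - z)`, so `G' < 1 - G²` says that `F` decreases.
  set F : ℝ → ℝ := fun z =>
    Real.log (1 + levelRate A B z) - Real.log (1 - levelRate A B z) - 2 * z with hF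
  have hd : ∀ z, 0 < z → ∃ g, HasDerivAt F g z ∧ g < 0 := by
    intro z hz
    obtain ⟨g, hg, hlt⟩ := hasDerivAt_levelRate hA hAB hP hz
    have h0 := hG0 hz
    have h1 := hG1 hz
    refine ⟨_, (((hg.const_add 1).log (by linarith)).sub
      ((hg.const_sub 1).log (by linarith))).sub ((hasDerivAt_id z).const_mul 2), ?_⟩
    have e : g / (1 + levelRate A B z) - -g / (1 - levelRate A B z) - 2 * 1 =
        2 * (g - (1 - levelRate A B z ^ 2)) /
          ((1 + levelRate A B z) * (1 - levelRate A B z)) := by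
      have : 1 + levelRate A B z ≠ 0 := by linarith
      have : 1 - levelRate A B z ≠ 0 := by linarith
      field_simp
      ring
    rw [e]
    exact div_neg_of_neg_of_pos (by linarith) (mul_pos (by linarith) (by linarith))
  have hanti : StrictAntiOn F (Ioi 0) := by
    apply strictAntiOn_of_deriv_neg (convex_Ioi 0)
    · intro z hz
      obtain ⟨g, hg, -⟩ := hd z hz
      exact hg.continuousAt.continuousWithinAt
    · intro z hz
      rw [interior_Ioi] at hz
      obtain ⟨g, hg, hlt⟩ := hd z hz
      rwa [hg.deriv]
  have hlimG : Filter.Tendsto (levelRate A B) (nhdsWithin 0 (Ioi 0)) (nhds 0) := by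
    have h2 : Filter.Tendsto (fun z : ℝ => 2 * A * B * z) (nhdsWithin 0 (Ioi 0)) (nhds 0) := by
      have : ContinuousAt (fun z : ℝ => 2 * A * B * z) 0 := by fun_prop
      simpa [ContinuousAt] using this.tendsto.mono_left nhdsWithin_le_nhds
    refine tendsto_of_tendsto_of_tendsto_of_le_of_le' tendsto_const_nhds h2 ?_ ?_
    · filter_upwards [self_mem_nhdsWithin] with z hz using (hG0 hz).le
    · filter_upwards [self_mem_nhdsWithin] with z hz using levelRate_le hA hAB hz
  have hlim : Filter.Tendsto F (nhdsWithin 0 (Ioi 0)) (nhds 0) := by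
    have h1 := (hlimG.const_add 1).log (by norm_num)
    have h2 := (hlimG.const_sub 1).log (by norm_num)
    have h3 : Filter.Tendsto (fun z : ℝ => 2 * z) (nhdsWithin 0 (Ioi 0)) (nhds (2 * 0)) :=
      (Filter.tendsto_id.mono_left nhdsWithin_le_nhds).const_mul 2
    simpa using (h1.sub h2).sub h3
  -- The limit at `0` gives only a weak inequality; the strict decrease from `h / 2` to `h` makes it
  -- strict.
  have hhalf : F (h / 2) ≤ 0 := by
    refine ge_of_tendsto hlim ?_
    filter_upwards [Ioo_mem_nhdsGT (half_pos hh)] with z hz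
    exact hanti.antitoneOn hz.1 (half_pos hh) hz.2.le
  have hneg : F h < 0 := (hanti (half_pos hh) hh (half_lt_self hh)).trans_le hhalf
  have h0 := hG0 hh
  have h1 := hG1 hh
  have hlog : Real.log (1 + levelRate A B h) < 2 * h + Real.log (1 - levelRate A B h) := by
    simp only [hF] at hneg
    linarith
  have hexp := Real.exp_lt_exp.2 hlog
  rw [Real.exp_add, Real.exp_log (by linarith), Real.exp_log (by linarith)] at hexp
  have e2 : Real.exp (2 * h) = Real.exp h * Real.exp h := by rw [← Real.exp_add, two_mul]
  have e1 : Real.exp h * Real.exp (-h) = 1 := by rw [← Real.exp_add]; simp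
  rw [Real.tanh_eq_sinh_div_cosh, lt_div_iff₀ (Real.cosh_pos h), Real.sinh_eq, Real.cosh_eq]
  rw [e2] at hexp
  have hn := Real.exp_pos (-h)
  have := mul_lt_mul_of_pos_right hexp hn
  have k : Real.exp h * Real.exp h * (1 - levelRate A B h) * Real.exp (-h) =
      Real.exp h * (1 - levelRate A B h) := by
    linear_combination Real.exp h * (1 - levelRate A B h) * e1
  rw [k] at this
  linarith

end LevelSlopes

/-! ### The explicit profile and its level intervals -/

section Profile

variable {A B H h : ℝ}

/-- The reciprocal of the Riccati solution in the centred logarithmic variable, with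
`A = α - β + 1`, `B = β + 1`, on `[-H, H]`. -/
noncomputable def profile (A B H x : ℝ) : ℝ :=
  (Real.sinh (A * H) * Real.exp (-(B * x)) + Real.sinh (B * H) * Real.exp (A * x)) /
    Real.sinh ((A + B) * H)

lemma profile_pos (hA : 0 < A) (hB : 0 < B) (hH : 0 < H) (x : ℝ) : 0 < profile A B H x := by
  have h1 := Real.sinh_pos_iff.2 (mul_pos hA hH)
  have h2 := Real.sinh_pos_iff.2 (mul_pos hB hH)
  have h3 := Real.sinh_pos_iff.2 (mul_pos (add_pos hA hB) hH)
  unfold profile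
  positivity

lemma profile_right (hA : 0 < A) (hB : 0 < B) (hH : 0 < H) : profile A B H H = 1 := by
  have h3 := Real.sinh_pos_iff.2 (mul_pos (add_pos hA hB) hH)
  rw [profile, div_eq_one_iff_eq h3.ne', add_mul, Real.sinh_add, ← Real.cosh_sub_sinh,
    ← Real.cosh_add_sinh]
  ring

lemma profile_left (hA : 0 < A) (hB : 0 < B) (hH : 0 < H) : profile A B H (-H) = 1 := by
  have h3 := Real.sinh_pos_iff.2 (mul_pos (add_pos hA hB) hH)
  rw [profile, div_eq_one_iff_eq h3.ne', add_mul, Real.sinh_add, mul_neg, mul_neg, neg_neg,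
    ← Real.cosh_sub_sinh, ← Real.cosh_add_sinh]
  ring

lemma profile_one_one (hH : 0 < H) (x : ℝ) :
    profile 1 1 H x = Real.cosh x / Real.cosh H := by
  have h1 := Real.sinh_pos_iff.2 hH
  have h2 := Real.cosh_pos H
  rw [profile, show ((1 : ℝ) + 1) * H = 2 * H by ring, Real.sinh_two_mul, one_mul, one_mul,
    Real.cosh_eq x]
  field_simp
  ring

lemma hasDerivAt_profile (A B H x : ℝ) :
    HasDerivAt (profile A B H)
      ((A * (Real.sinh (B * H) * Real.exp (A * x)) -
        B * (Real.sinh (A * H) * Real.exp (-(B * x)))) / Real.sinh ((A + B) * H)) x := by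
  refine HasDerivAt.congr_deriv
    (((((hasDerivAt_id x).const_mul B).neg.exp.const_mul _).add
      (((hasDerivAt_id x).const_mul A).exp.const_mul _)).div_const _) ?_
  simp only [id, Pi.neg_apply]
  ring

/-- A positive combination of exponentials is strictly convex, so it lies below the chord joining
its boundary values. -/
lemma profile_lt_one (hA : 0 < A) (hB : 0 < B) {x : ℝ} (hx : x ∈ Ioo (-H) H) :
    profile A B H x < 1 := by
  have hH : 0 < H := by linarith [hx.1, hx.2]
  have h1 := Real.sinh_pos_iff.2 (mul_pos hA hH)
  have h2 := Real.sinh_pos_iff.2 (mul_pos hB hH)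
  have h3 := Real.sinh_pos_iff.2 (mul_pos (add_pos hA hB) hH)
  set s := (H - x) / (2 * H) with hs
  set t := (x + H) / (2 * H) with ht
  have hs0 : 0 < s := div_pos (by linarith [hx.2]) (by linarith)
  have ht0 : 0 < t := div_pos (by linarith [hx.1]) (by linarith)
  have hst : s + t = 1 := by rw [hs, ht]; field_simp; ring
  have hxe : x = s * (-H) + t * H := by rw [hs, ht]; field_simp; ring
  have key : ∀ c : ℝ, c ≠ 0 →
      Real.exp (c * x) < s * Real.exp (c * -H) + t * Real.exp (c * H) := by
    intro c hc
    have := strictConvexOn_exp.2 (mem_univ (c * -H)) (mem_univ (c * H))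
      (fun h => by have := mul_left_cancel₀ hc h; linarith) hs0 ht0 hst
    simp only [smul_eq_mul] at this
    rwa [show s * (c * -H) + t * (c * H) = c * x by rw [hxe]; ring] at this
  have k1 := mul_lt_mul_of_pos_left (key (-B) (by linarith)) h1
  have k2 := mul_lt_mul_of_pos_left (key A hA.ne') h2
  have e1 := profile_left hA hB hH
  have e2 := profile_right hA hB hH
  rw [profile, div_eq_one_iff_eq h3.ne'] at e1 e2
  rw [profile, div_lt_one h3]
  simp only [neg_mul] at k1
  rw [show Real.sinh ((A + B) * H) = s * Real.sinh ((A + B) * H) + t * Real.sinh ((A + B) * H)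
    by rw [← add_mul, hst, one_mul]]
  nth_rewrite 1 [← e1]
  rw [← e2]
  linarith

/-- The midpoint of the level interval of half-length `h`, up to an additive constant. -/
noncomputable def levelShift (A B h : ℝ) : ℝ :=
  Real.log (Real.sinh (B * h) / Real.sinh (A * h)) / (A + B)

lemma hasDerivAt_levelShift (hA : 0 < A) (hB : 0 < B) (hh : 0 < h) :
    HasDerivAt (levelShift A B) ((B * coth (B * h) - A * coth (A * h)) / (A + B)) h := by
  have h1 := Real.sinh_pos_iff.2 (mul_pos hA hh)
  have h2 := Real.sinh_pos_iff.2 (mul_pos hB hh)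
  refine HasDerivAt.congr_deriv
    (((((hasDerivAt_id h).const_mul B).sinh.div ((hasDerivAt_id h).const_mul A).sinh h1.ne').log
      (div_pos h2 h1).ne').div_const (A + B)) ?_
  simp only [id, coth, Pi.div_apply]
  field_simp

/-- This is the condition that `profile` agree at distance `h` on either side of the midpoint;
solving it for the midpoint gives the formula of `levelShift`. -/
lemma level_balance (hA : 0 < A) (hB : 0 < B) (hH : 0 < H) (hh : 0 < h) :
    Real.sinh (B * H) * Real.exp (A * (levelShift A B h - levelShift A B H)) *
        Real.sinh (A * h) =
      Real.sinh (A * H) * Real.exp (-(B * (levelShift A B h - levelShift A B H))) *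
        Real.sinh (B * h) := by
  have h1 := Real.sinh_pos_iff.2 (mul_pos hA hh)
  have h2 := Real.sinh_pos_iff.2 (mul_pos hB hh)
  have h3 := Real.sinh_pos_iff.2 (mul_pos hA hH)
  have h4 := Real.sinh_pos_iff.2 (mul_pos hB hH)
  have hAB : A + B ≠ 0 := (add_pos hA hB).ne'
  set θ := levelShift A B h - levelShift A B H with hθ
  have e : (A + B) * θ = Real.log (Real.sinh (B * h) / Real.sinh (A * h)) -
      Real.log (Real.sinh (B * H) / Real.sinh (A * H)) := by
    rw [hθ, levelShift, levelShift]
    field_simp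
  have e1 : Real.exp (A * θ) = Real.exp (-(B * θ)) * Real.exp ((A + B) * θ) := by
    rw [← Real.exp_add]
    congr 1
    ring
  rw [e1, e, Real.exp_sub, Real.exp_log (by positivity), Real.exp_log (by positivity)]
  field_simp

/-- Right end of the level interval of half-length `h`. -/
noncomputable def levelRight (A B H h : ℝ) : ℝ := h + (levelShift A B h - levelShift A B H)

/-- Left end of the level interval of half-length `h`. -/
noncomputable def levelLeft (A B H h : ℝ) : ℝ := -h + (levelShift A B h - levelShift A B H)

lemma hasDerivAt_levelRight (H : ℝ) (hA : 0 < A) (hB : 0 < B) (hh : 0 < h) :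
    HasDerivAt (levelRight A B H)
      (1 + (B * coth (B * h) - A * coth (A * h)) / (A + B)) h :=
  (hasDerivAt_id h).add ((hasDerivAt_levelShift hA hB hh).sub_const _)

lemma hasDerivAt_levelLeft (H : ℝ) (hA : 0 < A) (hB : 0 < B) (hh : 0 < h) :
    HasDerivAt (levelLeft A B H)
      (-1 + (B * coth (B * h) - A * coth (A * h)) / (A + B)) h :=
  (hasDerivAt_id h).neg.add ((hasDerivAt_levelShift hA hB hh).sub_const _)

lemma levelShift_deriv_mem (hA : 0 < A) (hAB : A < B) (hh : 0 < h) :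
    (B * coth (B * h) - A * coth (A * h)) / (A + B) ∈ Ioo (0 : ℝ) 1 := by
  have h1 := coth_diff_pos hA hAB hh
  have h2 := coth_diff_le hA hAB hh
  have hs : 0 < A + B := by linarith
  exact ⟨div_pos h1 hs, by rw [div_lt_one hs]; linarith⟩

lemma strictMonoOn_levelRight (H : ℝ) (hA : 0 < A) (hAB : A < B) :
    StrictMonoOn (levelRight A B H) (Ioi 0) := by
  have hd : ∀ z ∈ Ioi (0 : ℝ), _ := fun z hz =>
    hasDerivAt_levelRight H hA (hA.trans hAB) (h := z) hz
  apply strictMonoOn_of_deriv_pos (convex_Ioi 0)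
  · exact fun z hz => (hd z hz).continuousAt.continuousWithinAt
  · intro z hz
    rw [interior_Ioi] at hz
    rw [(hd z hz).deriv]
    linarith [(levelShift_deriv_mem hA hAB hz).1]

lemma strictAntiOn_levelLeft (H : ℝ) (hA : 0 < A) (hAB : A < B) :
    StrictAntiOn (levelLeft A B H) (Ioi 0) := by
  have hd : ∀ z ∈ Ioi (0 : ℝ), _ := fun z hz =>
    hasDerivAt_levelLeft H hA (hA.trans hAB) (h := z) hz
  apply strictAntiOn_of_deriv_neg (convex_Ioi 0)
  · exact fun z hz => (hd z hz).continuousAt.continuousWithinAt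
  · intro z hz
    rw [interior_Ioi] at hz
    rw [(hd z hz).deriv]
    linarith [(levelShift_deriv_mem hA hAB hz).2]

lemma profile_levelLeft (hA : 0 < A) (hB : 0 < B) (hH : 0 < H) (hh : 0 < h) :
    profile A B H (levelLeft A B H h) = profile A B H (levelRight A B H h) := by
  have hb := level_balance hA hB hH hh
  rw [profile, profile, levelLeft, levelRight]
  congr 1
  simp only [mul_add, neg_add, Real.exp_add, mul_neg, neg_neg]
  rw [Real.sinh_eq (A * h), Real.sinh_eq (B * h)] at hb
  linear_combination (-2) * hb

lemma levelRate_eq (hA : 0 < A) (hAB : A < B) (hh : 0 < h) :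
    levelRate A B h = (B * coth (B * h) - A * coth (A * h) + A + B) *
      (A * coth (A * h) - B * coth (B * h) + A + B) /
        ((A + B) * (coth (A * h) + coth (B * h))) := by
  have h1 := coth_diff_pos hA hAB hh
  have h2 := coth_diff_le hA hAB hh
  have h3 := one_lt_coth (mul_pos hA hh)
  have h4 := one_lt_coth (mul_pos (hA.trans hAB) hh)
  rw [levelRate, leftInvSlope, rightInvSlope]
  generalize coth (A * h) = p at *
  generalize coth (B * h) = q at *
  have hne : B * q - A * p + A + B ≠ 0 := by linarith
  have hne' : A * p - B * q + A + B ≠ 0 := by linarith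
  have hpq : p + q ≠ 0 := by linarith
  have hABne : A + B ≠ 0 := by linarith
  have hs : (p + q) / (B * q - A * p + A + B) + (p + q) / (A * p - B * q + A + B) =
      2 * (A + B) * (p + q) / ((B * q - A * p + A + B) * (A * p - B * q + A + B)) := by
    rw [div_add_div _ _ hne hne', div_left_inj' (mul_ne_zero hne hne')]
    ring
  rw [hs]
  field_simp

lemma hasDerivAt_profile_levelRight (hA : 0 < A) (hAB : A < B) (hH : 0 < H) (hh : 0 < h) :
    HasDerivAt (fun h => profile A B H (levelRight A B H h))
      (levelRate A B h * profile A B H (levelRight A B H h)) h := by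
  have hB := hA.trans hAB
  have hb := level_balance hA hB hH hh
  have h1 := Real.sinh_pos_iff.2 (mul_pos hA hh)
  have h2 := Real.sinh_pos_iff.2 (mul_pos hB hh)
  have hp := (one_lt_coth (mul_pos hA hh)).trans' one_pos
  have hq := (one_lt_coth (mul_pos hB hh)).trans' one_pos
  have hAB' : A + B ≠ 0 := (add_pos hA hB).ne'
  refine HasDerivAt.congr_deriv
    ((hasDerivAt_profile A B H _).comp h (hasDerivAt_levelRight H hA hB hh)) ?_
  -- By `level_balance` the two exponential terms at the right end share a factor `K`: they are `K
  -- (coth (B h) - 1)` and `K (coth (A h) + 1)`.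
  have hX : Real.sinh (A * H) * Real.exp (-(B * levelRight A B H h)) =
      (Real.sinh (A * H) * Real.exp (-(B * (levelShift A B h - levelShift A B H))) *
        Real.sinh (B * h)) * (coth (B * h) - 1) := by
    rw [levelRight, mul_add, neg_add, Real.exp_add, ← Real.cosh_sub_sinh, coth]
    field_simp
  have hY : Real.sinh (B * H) * Real.exp (A * levelRight A B H h) =
      (Real.sinh (A * H) * Real.exp (-(B * (levelShift A B h - levelShift A B H))) *
        Real.sinh (B * h)) * (coth (A * h) + 1) := by
    rw [← hb, levelRight, mul_add, Real.exp_add, ← Real.cosh_add_sinh, coth]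
    field_simp
  rw [profile, hX, hY, levelRate_eq hA hAB hh]
  generalize Real.sinh (A * H) * Real.exp (-(B * (levelShift A B h - levelShift A B H))) *
        Real.sinh (B * h) = K
  generalize coth (A * h) = p at *
  generalize coth (B * h) = q at *
  have hpq : p + q ≠ 0 := by linarith
  field_simp
  ring

lemma levelRight_self : levelRight A B H H = H := by simp [levelRight]

lemma levelLeft_self : levelLeft A B H H = -H := by simp [levelLeft]

/-- The ratio of the level to `cosh h` has logarithmic derivative `levelRate - tanh < 0` and equals
`1 / cosh H` at `h = H`. -/
lemma cosh_div_cosh_lt_profile (hA : 0 < A) (hAB : A < B) (hP : A * B ≤ 1) (hh : h ∈ Ioo 0 H) :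
    Real.cosh h / Real.cosh H < profile A B H (levelRight A B H h) := by
  have hB := hA.trans hAB
  have hH : 0 < H := hh.1.trans hh.2
  have hd : ∀ z, 0 < z → HasDerivAt
      (fun z => profile A B H (levelRight A B H z) / Real.cosh z) _ z := fun z hz =>
    (hasDerivAt_profile_levelRight hA hAB hH hz).div (Real.hasDerivAt_cosh z)
      (Real.cosh_pos z).ne'
  have hanti : StrictAntiOn (fun z => profile A B H (levelRight A B H z) / Real.cosh z)
      (Ioi 0) := by
    apply strictAntiOn_of_deriv_neg (convex_Ioi 0)
    · exact fun z hz => (hd z hz).continuousAt.continuousWithinAt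
    · intro z hz
      rw [interior_Ioi] at hz
      rw [(hd z hz).deriv]
      have hlt := levelRate_lt_tanh hA hAB hP hz
      have hc := Real.cosh_pos z
      rw [Real.tanh_eq_sinh_div_cosh, lt_div_iff₀ hc] at hlt
      have := mul_pos (profile_pos hA hB hH (levelRight A B H z)) (sub_pos.2 hlt)
      exact div_neg_of_neg_of_pos (by linarith) (by positivity)
  have := hanti hh.1 hH hh.2
  simp only [levelRight_self, profile_right hA hB hH] at this
  rwa [lt_div_iff₀ (Real.cosh_pos h), one_div_mul_eq_div] at this

/-! ### Integrals over level intervals -/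

lemma lintegral_even_le {g : ℝ → ENNReal} (hg : ∀ x, g (-x) = g x) :
    ∫⁻ x in Ioo (-H) H, g x ≤ ∫⁻ x in Ioo 0 H, 2 * g x := by
  have himg : (fun x : ℝ => -x) '' Ioo 0 H = Ioo (-H) 0 := by simp
  have hneg : ∫⁻ x in Ioo (-H) 0, g x = ∫⁻ x in Ioo 0 H, g x := by
    rw [← himg, lintegral_image_eq_lintegral_abs_deriv_mul measurableSet_Ioo
      (fun x _ => (hasDerivAt_neg x).hasDerivWithinAt) neg_injective.injOn]
    simp [hg]
  have hsub : Ioo (-H) H ⊆ (Ioo (-H) 0 ∪ {0}) ∪ Ioo 0 H := by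
    intro x hx
    rcases lt_trichotomy x 0 with h | h | h
    · exact Or.inl (Or.inl ⟨hx.1, h⟩)
    · exact Or.inl (Or.inr h)
    · exact Or.inr ⟨h, hx.2⟩
  calc ∫⁻ x in Ioo (-H) H, g x ≤ ∫⁻ x in (Ioo (-H) 0 ∪ {0}) ∪ Ioo 0 H, g x :=
        lintegral_mono_set hsub
    _ ≤ (∫⁻ x in Ioo (-H) 0 ∪ {0}, g x) + ∫⁻ x in Ioo 0 H, g x := lintegral_union_le _ _ _
    _ ≤ ((∫⁻ x in Ioo (-H) 0, g x) + ∫⁻ x in {0}, g x) + ∫⁻ x in Ioo 0 H, g x := by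
        gcongr
        exact lintegral_union_le _ _ _
    _ = 2 * ∫⁻ x in Ioo 0 H, g x := by rw [hneg]; simp [two_mul]
    _ = ∫⁻ x in Ioo 0 H, 2 * g x := (lintegral_const_mul' _ _ (by simp)).symm

/-- Change variables by both ends of the level interval. Their Jacobians are `1 - c` and `1 + c`,
with `c` the derivative of the midpoint, and add up to `2`. The images are disjoint in `(-H, H)`;
that they fill it is not needed. -/
lemma lintegral_level_le (hA : 0 < A) (hAB : A < B) (hH : 0 < H) {g : ℝ → ENNReal}
    (hg : AEMeasurable (fun h => g (profile A B H (levelRight A B H h)))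
      (volume.restrict (Ioo 0 H))) :
    ∫⁻ h in Ioo 0 H, 2 * g (profile A B H (levelRight A B H h)) ≤
      ∫⁻ x in Ioo (-H) H, g (profile A B H x) := by
  have hB := hA.trans hAB
  have hR := (strictMonoOn_levelRight H hA hAB).mono (fun z (hz : z ∈ Ioo 0 H) => hz.1)
  have hL := (strictAntiOn_levelLeft H hA hAB).mono (fun z (hz : z ∈ Ioo 0 H) => hz.1)
  have hlt : ∀ x y, 0 < x → 0 < y → levelLeft A B H x < levelRight A B H y := by
    intro x y hx hy
    have hm := lt_min hx hy
    calc levelLeft A B H x ≤ levelLeft A B H (min x y) :=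
          (strictAntiOn_levelLeft H hA hAB).antitoneOn hm hx (min_le_left _ _)
      _ < levelRight A B H (min x y) := by rw [levelLeft, levelRight]; linarith
      _ ≤ levelRight A B H y :=
          (strictMonoOn_levelRight H hA hAB).monotoneOn hm hy (min_le_right _ _)
  have hdR : ∀ z ∈ Ioo 0 H, HasDerivWithinAt (levelRight A B H)
      (1 + (B * coth (B * z) - A * coth (A * z)) / (A + B)) (Ioo 0 H) z :=
    fun z hz => (hasDerivAt_levelRight H hA hB hz.1).hasDerivWithinAt
  have hdL : ∀ z ∈ Ioo 0 H, HasDerivWithinAt (levelLeft A B H)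
      (-1 + (B * coth (B * z) - A * coth (A * z)) / (A + B)) (Ioo 0 H) z :=
    fun z hz => (hasDerivAt_levelLeft H hA hB hz.1).hasDerivWithinAt
  have hmR : MeasurableSet (levelRight A B H '' Ioo 0 H) :=
    measurableSet_Ioo.image_of_continuousOn_injOn
      (fun z hz => (hdR z hz).continuousWithinAt) hR.injOn
  have hdisj : Disjoint (levelLeft A B H '' Ioo 0 H) (levelRight A B H '' Ioo 0 H) := by
    rw [Set.disjoint_left]
    rintro _ ⟨x, hx, rfl⟩ ⟨y, hy, hxy⟩
    exact (hlt x y hx.1 hy.1).ne hxy.symm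
  have hsub : levelLeft A B H '' Ioo 0 H ∪ levelRight A B H '' Ioo 0 H ⊆ Ioo (-H) H := by
    rintro _ (⟨x, hx, rfl⟩ | ⟨x, hx, rfl⟩)
    · refine ⟨?_, ?_⟩
      · simpa only [levelLeft_self] using strictAntiOn_levelLeft H hA hAB hx.1 hH hx.2
      · simpa only [levelRight_self] using hlt x H hx.1 hH
    · refine ⟨?_, ?_⟩
      · simpa only [levelLeft_self] using hlt H x hH hx.1
      · simpa only [levelRight_self] using strictMonoOn_levelRight H hA hAB hx.1 hH hx.2
  have hmeas : AEMeasurable (fun z => ENNReal.ofReal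
      |1 + (B * coth (B * z) - A * coth (A * z)) / (A + B)|) (volume.restrict (Ioo 0 H)) := by
    unfold coth
    fun_prop
  calc ∫⁻ h in Ioo 0 H, 2 * g (profile A B H (levelRight A B H h))
      = ∫⁻ z in Ioo 0 H,
          (ENNReal.ofReal |-1 + (B * coth (B * z) - A * coth (A * z)) / (A + B)| +
            ENNReal.ofReal |1 + (B * coth (B * z) - A * coth (A * z)) / (A + B)|) *
            g (profile A B H (levelRight A B H z)) := by
        refine setLIntegral_congr_fun measurableSet_Ioo fun z hz => ?_
        have hc := levelShift_deriv_mem hA hAB hz.1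
        rw [abs_of_neg (by linarith [hc.2]), abs_of_pos (by linarith [hc.1]),
          ← ENNReal.ofReal_add (by linarith [hc.2]) (by linarith [hc.1])]
        congr 1
        rw [show ∀ t : ℝ, -(-1 + t) + (1 + t) = 2 by intro t; ring]
        simp
    _ = ∫⁻ z in Ioo 0 H,
          (ENNReal.ofReal |-1 + (B * coth (B * z) - A * coth (A * z)) / (A + B)| *
            g (profile A B H (levelLeft A B H z)) +
            ENNReal.ofReal |1 + (B * coth (B * z) - A * coth (A * z)) / (A + B)| *
            g (profile A B H (levelRight A B H z))) := by
        refine setLIntegral_congr_fun measurableSet_Ioo fun z hz => ?_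
        rw [profile_levelLeft hA hB hH hz.1, add_mul]
    _ ≤ ∫⁻ x in Ioo (-H) H, g (profile A B H x) := by
        have hm : AEMeasurable (fun z => ENNReal.ofReal
            |1 + (B * coth (B * z) - A * coth (A * z)) / (A + B)| *
              g (profile A B H (levelRight A B H z))) (volume.restrict (Ioo 0 H)) := hmeas.mul hg
        rw [lintegral_add_right' _ hm,
          ← lintegral_image_eq_lintegral_abs_deriv_mul measurableSet_Ioo hdL hL.injOn
            (fun x => g (profile A B H x)),
          ← lintegral_image_eq_lintegral_abs_deriv_mul measurableSet_Ioo hdR hR.injOn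
            (fun x => g (profile A B H x)),
          ← lintegral_union hmR hdisj]
        exact lintegral_mono_set hsub

theorem lintegral_cosh_lt_lintegral_profile (hA : 0 < A) (hAB : A < B) (hP : A * B ≤ 1)
    (hH : 0 < H) {φ : ℝ → ℝ} (hφ : ContinuousOn φ (Ioi 1)) (hφ0 : ∀ t ∈ Ioi (1 : ℝ), 0 ≤ φ t)
    (hanti : StrictAntiOn φ (Ioi 1))
    (hfin : ∫⁻ x in Ioo (-H) H, ENNReal.ofReal (φ (Real.cosh H / Real.cosh x)) < ⊤) :
    ∫⁻ x in Ioo (-H) H, ENNReal.ofReal (φ (Real.cosh H / Real.cosh x)) <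
      ∫⁻ x in Ioo (-H) H, ENNReal.ofReal (φ (1 / profile A B H x)) := by
  have hB := hA.trans hAB
  have hmem : ∀ h ∈ Ioo 0 H, 1 < 1 / profile A B H (levelRight A B H h) := by
    intro h hh
    rw [one_lt_div (profile_pos hA hB hH _)]
    refine profile_lt_one hA hB ⟨?_, ?_⟩
    · have h2 := strictAntiOn_levelLeft H hA hAB hh.1 hH hh.2
      rw [levelLeft_self] at h2
      refine h2.trans ?_
      rw [levelLeft, levelRight]
      linarith [hh.1]
    · simpa only [levelRight_self] using strictMonoOn_levelRight H hA hAB hh.1 hH hh.2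
  have hlt : ∀ h ∈ Ioo 0 H, 1 / profile A B H (levelRight A B H h) <
      Real.cosh H / Real.cosh h := by
    intro h hh
    have := cosh_div_cosh_lt_profile hA hAB hP hh
    rw [← one_div_div (Real.cosh h)]
    exact one_div_lt_one_div_of_lt (div_pos (Real.cosh_pos _) (Real.cosh_pos _)) this
  have hmeas : AEMeasurable (fun h => ENNReal.ofReal
      (φ (1 / profile A B H (levelRight A B H h)))) (volume.restrict (Ioo 0 H)) := by
    refine (ContinuousOn.aemeasurable ?_ measurableSet_Ioo).ennreal_ofReal
    refine hφ.comp (fun h hh => ?_) hmem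
    exact (continuousAt_const.div
      (hasDerivAt_profile_levelRight hA hAB hH hh.1).continuousAt
      (profile_pos hA hB hH _).ne').continuousWithinAt
  have hle := lintegral_level_le hA hAB hH (g := fun v => ENNReal.ofReal (φ (1 / v))) hmeas
  refine lt_of_lt_of_le ?_ hle
  have heven := lintegral_even_le (H := H)
    (g := fun x => ENNReal.ofReal (φ (Real.cosh H / Real.cosh x))) (by simp)
  refine lt_of_le_of_lt heven ?_
  have hsub : Ioo 0 H ⊆ Ioo (-H) H := Ioo_subset_Ioo_left (by linarith)
  -- Pointwise strictness passes to the integrals because the smaller one is finite.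
  refine lintegral_strict_mono ?_ (hmeas.const_mul 2) ?_ ?_
  · simp [Measure.restrict_eq_zero, hH]
  · rw [lintegral_const_mul' _ _ (by simp)]
    exact ENNReal.mul_ne_top (by simp) ((lintegral_mono_set hsub).trans_lt hfin).ne
  · refine (ae_restrict_iff' measurableSet_Ioo).2 (Filter.Eventually.of_forall fun h hh => ?_)
    have h1 := hmem h hh
    have h2 := hlt h hh
    have h3 := hanti h1 (h1.trans h2) h2
    refine ENNReal.mul_lt_mul_right (by simp) (by simp) ?_
    exact (ENNReal.ofReal_lt_ofReal_iff ((hφ0 _ (h1.trans h2)).trans_lt h3)).2 h3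

/-- The integrand has antiderivative `arcsin (sinh x / sinh H)`, which runs from `-π / 2` to `π /
2`. -/
theorem lintegral_inv_sqrt_cosh (hH : 0 < H) :
    ∫⁻ x in Ioo (-H) H,
      ENNReal.ofReal (1 / Real.sqrt ((Real.cosh H / Real.cosh x) ^ 2 - 1)) =
      ENNReal.ofReal Real.pi := by
  have hS := Real.sinh_pos_iff.2 hH
  have hd : ∀ x ∈ Ioo (-H) H, HasDerivAt (fun x => Real.arcsin (Real.sinh x / Real.sinh H))
      (1 / Real.sqrt ((Real.cosh H / Real.cosh x) ^ 2 - 1)) x := by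
    intro x hx
    have h1 : Real.sinh x < Real.sinh H := Real.sinh_lt_sinh.2 hx.2
    have h2 : -Real.sinh H < Real.sinh x := by
      rw [← Real.sinh_neg]; exact Real.sinh_lt_sinh.2 hx.1
    have h3 : -1 < Real.sinh x / Real.sinh H := by rw [lt_div_iff₀ hS]; linarith
    have h4 : Real.sinh x / Real.sinh H < 1 := by rw [div_lt_one hS]; exact h1
    refine HasDerivAt.congr_deriv (HasDerivAt.comp x (h₂ := Real.arcsin)
      (Real.hasDerivAt_arcsin h3.ne' h4.ne) ((Real.hasDerivAt_sinh x).div_const (Real.sinh H))) ?_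
    have hc := Real.cosh_pos x
    have hpos : 0 < Real.sinh H ^ 2 - Real.sinh x ^ 2 := by nlinarith
    have e1 : 1 - (Real.sinh x / Real.sinh H) ^ 2 =
        (Real.sinh H ^ 2 - Real.sinh x ^ 2) / Real.sinh H ^ 2 := by field_simp
    have e2 : (Real.cosh H / Real.cosh x) ^ 2 - 1 =
        (Real.sinh H ^ 2 - Real.sinh x ^ 2) / Real.cosh x ^ 2 := by
      rw [div_pow, Real.cosh_sq H, eq_div_iff (by positivity), sub_mul,
        div_mul_cancel₀ _ (by positivity), Real.cosh_sq x]
      ring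
    rw [e1, e2, Real.sqrt_div hpos.le, Real.sqrt_div hpos.le, Real.sqrt_sq hS.le,
      Real.sqrt_sq hc.le]
    field_simp
  have hcont : ContinuousOn (fun x => Real.arcsin (Real.sinh x / Real.sinh H)) (Icc (-H) H) :=
    (Real.continuous_arcsin.comp (Real.continuous_sinh.div_const _)).continuousOn
  have hle : -H ≤ H := by linarith
  have hint : IntegrableOn (fun x => 1 / Real.sqrt ((Real.cosh H / Real.cosh x) ^ 2 - 1))
      (Ioc (-H) H) :=
    intervalIntegral.integrableOn_deriv_of_nonneg hcont hd (fun x _ => by positivity)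
  have hval := intervalIntegral.integral_eq_sub_of_hasDerivAt_of_le hle hcont hd
    ((intervalIntegrable_iff_integrableOn_Ioc_of_le hle).2 hint)
  rw [Real.sinh_neg, neg_div, div_self hS.ne', Real.arcsin_neg, Real.arcsin_one,
    intervalIntegral.integral_of_le hle, integral_Ioc_eq_integral_Ioo] at hval
  rw [← ofReal_integral_eq_lintegral_ofReal (hint.mono_set Ioo_subset_Ioc_self)
    (Filter.Eventually.of_forall fun x => by positivity), hval]
  congr 1
  ring

end Profile

/-! ### From the Riccati problem to the profile -/

section Riccati

variable {α β a b l : ℝ} {w : ℝ → ℝ}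

/-- The linearisation of the Riccati equation: `τ ^ (β + 1) / w` is affine in `τ ^ (α + 2)`. -/
lemma IsRiccatiSolution.mul_affine_eq (hw : IsRiccatiSolution α β a b w l) (ha : 0 < a)
    (hα : 0 < α + 2) :
    ∃ C D : ℝ, ∀ τ ∈ Icc a b, w τ * (C + D * τ ^ (α + 2)) = τ ^ (β + 1) := by
  set D := l / (α + 2) with hD
  set C := a ^ (β + 1) - D * a ^ (α + 2) with hC
  refine ⟨C, D, ?_⟩
  have hpos : ∀ τ ∈ Icc a b, 0 < τ := fun τ hτ => ha.trans_le hτ.1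
  have hwc : ContinuousOn w (Icc a b) := hw.contDiffOn.continuousOn
  have hrc : ∀ p : ℝ, ContinuousOn (fun τ : ℝ => τ ^ p) (Icc a b) := fun p =>
    continuousOn_id.rpow_const fun τ hτ => Or.inl (hpos τ hτ).ne'
  have hgc : ContinuousOn (fun τ => (β + 1) / τ - l * τ ^ (α - β) * w τ) (Icc a b) :=
    (continuousOn_const.div continuousOn_id fun τ hτ => (hpos τ hτ).ne').sub
      ((continuousOn_const.mul (hrc _)).mul hwc)
  obtain ⟨K, hK⟩ := isCompact_Icc.exists_bound_of_continuousOn hgc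
  -- The defect `E` avoids dividing by `w`, not yet known to be nonzero. It solves a linear
  -- homogeneous equation, and `C` is chosen so that `E a = 0`.
  set E : ℝ → ℝ := fun τ => w τ * (C + D * τ ^ (α + 2)) - τ ^ (β + 1) with hE
  have hEc : ContinuousOn E (Icc a b) :=
    (hwc.mul (continuousOn_const.add (continuousOn_const.mul (hrc _)))).sub (hrc _)
  have hEd : ∀ τ ∈ Ioo a b,
      HasDerivAt E (E τ * ((β + 1) / τ - l * τ ^ (α - β) * w τ)) τ := by
    intro τ hτ
    have hτ0 := hpos τ (Ioo_subset_Icc_self hτ)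
    have hwd : HasDerivAt w (deriv w τ) τ :=
      ((hw.contDiffOn.differentiableOn one_ne_zero).differentiableAt
        (Icc_mem_nhds hτ.1 hτ.2)).hasDerivAt
    have hr : ∀ p : ℝ, HasDerivAt (fun τ : ℝ => τ ^ p) (p * τ ^ (p - 1)) τ := fun p =>
      Real.hasDerivAt_rpow_const (Or.inl hτ0.ne')
    refine HasDerivAt.congr_deriv
      ((hwd.mul (((hr (α + 2)).const_mul D).const_add C)).sub (hr (β + 1))) ?_
    have hode := hw.ode τ hτ
    have e1 : τ ^ (α + 2 - 1) = τ ^ (α - β) * τ ^ (β + 1) := by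
      rw [← Real.rpow_add hτ0]; congr 1; ring
    have e2 : τ ^ (β + 1 - 1) = τ ^ (β + 1) / τ := by
      rw [Real.rpow_sub hτ0, Real.rpow_one]
    have e3 : D * (α + 2) = l := div_mul_cancel₀ _ hα.ne'
    rw [e1, e2, hE]
    linear_combination (C + D * τ ^ (α + 2)) * hode +
      w τ * τ ^ (α - β) * τ ^ (β + 1) * e3
  -- Grönwall: `K` bounds the coefficient of the equation for `E`, so this nonnegative function
  -- starts at `0` and cannot grow.
  have hanti : AntitoneOn (fun τ => E τ ^ 2 * Real.exp (-(2 * K * τ))) (Icc a b) := by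
    have hd : ∀ τ ∈ Ioo a b, HasDerivAt (fun τ => E τ ^ 2 * Real.exp (-(2 * K * τ)))
        (2 * E τ ^ 2 * Real.exp (-(2 * K * τ)) *
          (((β + 1) / τ - l * τ ^ (α - β) * w τ) - K)) τ := by
      intro τ hτ
      refine HasDerivAt.congr_deriv
        (((hEd τ hτ).pow 2).mul (((hasDerivAt_id τ).const_mul (2 * K)).neg.exp)) ?_
      simp only [id, Pi.pow_apply, Pi.neg_apply]
      push_cast
      ring
    apply antitoneOn_of_deriv_nonpos (convex_Icc a b)
    · exact (hEc.pow 2).mul (by fun_prop)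
    · rw [interior_Icc]
      exact fun τ hτ => (hd τ hτ).differentiableAt.differentiableWithinAt
    · rw [interior_Icc]
      intro τ hτ
      rw [(hd τ hτ).deriv]
      have := (le_abs_self _).trans (hK τ (Ioo_subset_Icc_self hτ))
      exact mul_nonpos_of_nonneg_of_nonpos (by positivity) (by linarith)
  intro τ hτ
  have hEa : E a = 0 := by simp only [hE, hw.left, hC]; ring
  have h := hanti (left_mem_Icc.2 (hτ.1.trans hτ.2)) hτ hτ.1
  simp only [hEa] at h
  have h2 : E τ ^ 2 ≤ 0 := by
    have := Real.exp_pos (-(2 * K * τ))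
    by_contra! hc
    have := mul_pos hc this
    simp at h
    linarith
  have h3 : E τ = 0 := by nlinarith
  simp only [hE] at h3
  linarith

/-- The two boundary values determine both constants of the affine form, hence also `l`; the profile
has the same form and the same boundary values. -/
lemma IsRiccatiSolution.eq_one_div_profile (hw : IsRiccatiSolution α β a b w l) (ha : 0 < a)
    (hab : a < b) (hA : 0 < α - β + 1) (hB : 0 < β + 1) {τ : ℝ} (hτ : τ ∈ Icc a b) :
    w τ = 1 / profile (α - β + 1) (β + 1) ((Real.log b - Real.log a) / 2)
      (Real.log τ - (Real.log a + Real.log b) / 2) := by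
  have hb := ha.trans hab
  have hα : 0 < α + 2 := by linarith
  obtain ⟨C, D, hCD⟩ := hw.mul_affine_eq ha hα
  set A := α - β + 1 with hAdef
  set B := β + 1 with hBdef
  have hsum : α + 2 = A + B := by rw [hAdef, hBdef]; ring
  rw [hsum] at hCD hα
  set H := (Real.log b - Real.log a) / 2 with hHdef
  set m := (Real.log a + Real.log b) / 2 with hmdef
  have hH : 0 < H := by
    have := Real.log_lt_log ha hab
    rw [hHdef]; linarith
  have hs := Real.sinh_pos_iff.2 (mul_pos hα hH)
  set C' := Real.exp (B * m) * Real.sinh (A * H) / Real.sinh ((A + B) * H) with hC'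
  set D' := Real.exp (-(A * m)) * Real.sinh (B * H) / Real.sinh ((A + B) * H) with hD'
  have key : ∀ σ, 0 < σ → C' + D' * σ ^ (A + B) = σ ^ B * profile A B H (Real.log σ - m) := by
    intro σ hσ
    rw [hC', hD', profile, Real.rpow_def_of_pos hσ, Real.rpow_def_of_pos hσ]
    have e1 : Real.exp (Real.log σ * B) * Real.exp (-(B * (Real.log σ - m))) =
        Real.exp (B * m) := by rw [← Real.exp_add]; congr 1; ring
    have e2 : Real.exp (Real.log σ * B) * Real.exp (A * (Real.log σ - m)) =
        Real.exp (-(A * m)) * Real.exp (Real.log σ * (A + B)) := by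
      rw [← Real.exp_add, ← Real.exp_add]; congr 1; ring
    rw [div_mul_eq_mul_div, ← add_div, ← mul_div_assoc (Real.exp (Real.log σ * B)),
      div_left_inj' hs.ne']
    linear_combination -Real.sinh (A * H) * e1 - Real.sinh (B * H) * e2
  have ka := key a ha
  have kb := key b hb
  rw [show Real.log a - m = -H by rw [hmdef, hHdef]; ring, profile_left hA hB hH] at ka
  rw [show Real.log b - m = H by rw [hmdef, hHdef]; ring, profile_right hA hB hH] at kb
  have la := hCD a (left_mem_Icc.2 hab.le)
  have lb := hCD b (right_mem_Icc.2 hab.le)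
  rw [hw.left] at la
  rw [hw.right] at lb
  have hlt : a ^ (A + B) < b ^ (A + B) := Real.rpow_lt_rpow ha.le hab hα
  have hDD : D = D' := by
    have : (D - D') * (b ^ (A + B) - a ^ (A + B)) = 0 := by linarith
    rcases mul_eq_zero.1 this with h | h <;> linarith
  have hCC : C = C' := by rw [hDD] at la; linarith
  have hτ0 : 0 < τ := ha.trans_le hτ.1
  have h := hCD τ hτ
  rw [hCC, hDD, key τ hτ0] at h
  have hτB : 0 < τ ^ B := Real.rpow_pos_of_pos hτ0 _
  rw [eq_div_iff (profile_pos hA hB hH _).ne']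
  refine mul_left_cancel₀ hτB.ne' ?_
  linarith

/-- Under `τ = exp (m + x)` the measure `dτ / τ` becomes Lebesgue measure `dx`. -/
lemma setLIntegral_logMeasure (ha : 0 < a) (hab : a < b) (f : ℝ → ENNReal) :
    ∫⁻ τ in Ioo a b, f τ ∂logMeasure =
      ∫⁻ x in Ioo (-((Real.log b - Real.log a) / 2)) ((Real.log b - Real.log a) / 2),
        f (Real.exp ((Real.log a + Real.log b) / 2 + x)) := by
  have hb := ha.trans hab
  set H := (Real.log b - Real.log a) / 2 with hHdef
  set m := (Real.log a + Real.log b) / 2 with hmdef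
  have himg : (fun x => Real.exp (m + x)) '' Ioo (-H) H = Ioo a b := by
    ext τ
    constructor
    · rintro ⟨x, hx, rfl⟩
      refine ⟨?_, ?_⟩
      · rw [← Real.log_lt_iff_lt_exp ha]
        linarith [hx.1]
      · rw [← Real.lt_log_iff_exp_lt hb]
        linarith [hx.2]
    · intro hτ
      have hτ0 := ha.trans hτ.1
      have h1 := Real.log_lt_log ha hτ.1
      have h2 := Real.log_lt_log hτ0 hτ.2
      refine ⟨Real.log τ - m, ⟨by linarith, by linarith⟩, ?_⟩
      simp [Real.exp_log hτ0]
  have hsub : Ioo a b ⊆ Ioi 0 := fun τ hτ => ha.trans hτ.1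
  have hd : ∀ x ∈ Ioo (-H) H,
      HasDerivWithinAt (fun x => Real.exp (m + x)) (Real.exp (m + x)) (Ioo (-H) H) x := by
    intro x _
    simpa using (((hasDerivAt_id x).const_add m).exp).hasDerivWithinAt
  have hmeas : Measurable (fun x : ℝ => ENNReal.ofReal (1 / x)) := by fun_prop
  rw [logMeasure, restrict_withDensity measurableSet_Ioo,
    Measure.restrict_restrict measurableSet_Ioo, inter_eq_self_of_subset_left hsub,
    lintegral_withDensity_eq_lintegral_mul_non_measurable _ hmeas
      (Filter.Eventually.of_forall fun x => ENNReal.ofReal_lt_top), ← himg,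
    lintegral_image_eq_lintegral_abs_deriv_mul measurableSet_Ioo hd
      (fun x _ y _ h => by simpa using h)]
  refine lintegral_congr fun x => ?_
  have hx := Real.exp_pos (m + x)
  simp only [Pi.mul_apply, abs_of_pos hx]
  rw [← mul_assoc, ← ENNReal.ofReal_mul hx.le, mul_one_div_cancel hx.ne', ENNReal.ofReal_one,
    one_mul]

lemma IsRiccatiSolution.lintegral_eq (hw : IsRiccatiSolution α β a b w l) (ha : 0 < a)
    (hab : a < b) (hA : 0 < α - β + 1) (hB : 0 < β + 1) (f : ℝ → ENNReal) :
    ∫⁻ τ in Ioo a b, f (w τ) ∂logMeasure =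
      ∫⁻ x in Ioo (-((Real.log b - Real.log a) / 2)) ((Real.log b - Real.log a) / 2),
        f (1 / profile (α - β + 1) (β + 1) ((Real.log b - Real.log a) / 2) x) := by
  rw [setLIntegral_logMeasure ha hab]
  refine setLIntegral_congr_fun measurableSet_Ioo fun x hx => ?_
  have hmem : Real.exp ((Real.log a + Real.log b) / 2 + x) ∈ Icc a b := by
    refine ⟨?_, ?_⟩
    · rw [← Real.log_le_iff_le_exp ha]
      linarith [hx.1]
    · rw [← Real.le_log_iff_exp_le (ha.trans hab)]
      linarith [hx.2]
  rw [hw.eq_one_div_profile ha hab hA hB hmem, Real.log_exp, add_sub_cancel_left]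

lemma IsRiccatiSolution.one_lt (hw : IsRiccatiSolution α β a b w l) (ha : 0 < a)
    (hab : a < b) (hA : 0 < α - β + 1) (hB : 0 < β + 1) {τ : ℝ} (hτ : τ ∈ Ioo a b) :
    1 < w τ := by
  have hτ0 := ha.trans hτ.1
  have h1 := Real.log_lt_log ha hτ.1
  have h2 := Real.log_lt_log hτ0 hτ.2
  rw [hw.eq_one_div_profile ha hab hA hB (Ioo_subset_Icc_self hτ),
    one_lt_div (profile_pos hA hB (by linarith) _)]
  exact profile_lt_one hA hB ⟨by linarith, by linarith⟩

end Riccati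

/-! ### The test function `1 / √(t² - 1)` and the conclusion -/

lemma inv_sqrt_sq_sub_one_pos {t : ℝ} (ht : 1 < t) : 0 < Real.sqrt (t ^ 2 - 1) :=
  Real.sqrt_pos.2 (by nlinarith)

lemma continuousOn_inv_sqrt_sq_sub_one :
    ContinuousOn (fun t : ℝ => 1 / Real.sqrt (t ^ 2 - 1)) (Ioi 1) :=
  continuousOn_const.div (by fun_prop) fun _ ht => (inv_sqrt_sq_sub_one_pos ht).ne'

lemma strictAntiOn_inv_sqrt_sq_sub_one :
    StrictAntiOn (fun t : ℝ => 1 / Real.sqrt (t ^ 2 - 1)) (Ioi 1) := by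
  intro s hs t ht hst
  have hs' : (1 : ℝ) < s := hs
  exact one_div_lt_one_div_of_lt (inv_sqrt_sq_sub_one_pos hs)
    (Real.sqrt_lt_sqrt (by nlinarith) (by nlinarith))

theorem mainTheorem10 (α β : ℝ) (hP : (α, β) ∈ paramSet \ paramSetMinus)
    (a b : ℝ) (ha : 0 < a) (hab : a < b)
    (w : ℝ → ℝ) (l : ℝ) (hw : IsRiccatiSolution α β a b w l) :
    (∀ τ ∈ Ioo a b, 1 < w τ) ∧
    (∀ (w₀ : ℝ → ℝ) (l₀ : ℝ), IsRiccatiSolution 0 0 a b w₀ l₀ →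
      (∀ τ ∈ Ioo a b, 1 < w₀ τ) ∧
      ∀ φ : ℝ → ℝ, ContDiffOn ℝ 1 φ (Ioi 1) → (∀ t ∈ Ioi (1 : ℝ), 0 ≤ φ t) →
        StrictAntiOn φ (Ioi 1) →
        ∫⁻ τ in Ioo a b, ENNReal.ofReal (φ (w₀ τ)) ∂logMeasure < ⊤ →
        ∫⁻ τ in Ioo a b, ENNReal.ofReal (φ (w₀ τ)) ∂logMeasure <
          ∫⁻ τ in Ioo a b, ENNReal.ofReal (φ (w τ)) ∂logMeasure) ∧
    ENNReal.ofReal Real.pi <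
      ∫⁻ τ in Ioo a b, ENNReal.ofReal (1 / Real.sqrt ((w τ) ^ 2 - 1)) ∂logMeasure := by
  obtain ⟨⟨h1, h2, h3⟩, hminus⟩ := hP
  simp only at h1 h2 h3
  have hA : 0 < α - β + 1 := h1
  -- On expanding, `A * B - 1 = α (β + 1) - β²`.
  have hprod : (α - β + 1) * (β + 1) ≤ 1 := by linarith
  have hB : 0 < β + 1 := by linarith
  have hAB : α - β + 1 < β + 1 := by
    -- On the line `α = 2 β` the third condition reads `β (β + 2) ≤ 0`; with `β > -1` this forces `β
    -- ≤ 0`, so the point would lie in `paramSetMinus`.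
    have hne : α ≠ 2 * β := by
      intro he
      refine hminus ⟨?_, ?_, he⟩
      · change -2 < α
        linarith
      · change α ≤ 0
        nlinarith
    have := lt_of_le_of_ne h2 hne
    linarith
  have hH : 0 < (Real.log b - Real.log a) / 2 := by
    have := Real.log_lt_log ha hab
    linarith
  refine ⟨fun τ hτ => hw.one_lt ha hab hA hB hτ, fun w₀ l₀ hw₀ => ⟨fun τ hτ =>
    hw₀.one_lt ha hab (by norm_num) (by norm_num) hτ, fun φ hφ hφ0 hanti hfin => ?_⟩, ?_⟩
  · have e := hw₀.lintegral_eq ha hab (by norm_num) (by norm_num)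
      (fun t => ENNReal.ofReal (φ t))
    simp only [sub_zero, zero_add, profile_one_one hH, one_div_div] at e
    rw [e] at hfin ⊢
    rw [hw.lintegral_eq ha hab hA hB (fun t => ENNReal.ofReal (φ t))]
    exact lintegral_cosh_lt_lintegral_profile hA hAB hprod hH hφ.continuousOn hφ0 hanti hfin
  · rw [hw.lintegral_eq ha hab hA hB (fun t => ENNReal.ofReal (1 / Real.sqrt (t ^ 2 - 1))),
      ← lintegral_inv_sqrt_cosh hH]
    refine lintegral_cosh_lt_lintegral_profile hA hAB hprod hH continuousOn_inv_sqrt_sq_sub_one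
      (fun t _ => by positivity) strictAntiOn_inv_sqrt_sq_sub_one ?_
    rw [lintegral_inv_sqrt_cosh hH]
    exact ENNReal.ofReal_lt_top
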